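/- Let $n\ge 0$. A \emph{labelled poset} is a partial order $\lhd$ on the set $\{1,\dots,n\}$; its \emph{linear extensions} are the permutations $\sigma\in\mathfrak S_n$, written as words, in which $a$ appears before $b$ whenever $a\lhd b$ and $a\neq b$. An \emph{interval-poset} of size $n$ is a labelled poset $P$ such that for all $a<b<c$: $a\lhd_P c$ implies $b\lhd_P c$, and $c\lhd_P a$ implies $b\lhd_P a$. The \emph{Tamari order} on planar binary trees with $n$ nodes is the reflexive transitive closure of the right rotation, which replaces a subtree $y(x(A,B),C)$ by $x(A,y(B,C))$. Label the nodes of such a tree $T$ by $1,\dots,n$ as a binary search tree (each label is larger than the labels in the left subtree of its node and smaller than those in the right subtree); then $T$ is a labelled poset, with $a\lhd_T b$ if and only if $a$ lies in the subtree rooted at $b$. The \emph{sylvester class} of $T$ is its set of linear extensions. The \emph{right weak order} on $\mathfrak S_n$ is given by $\mu\le\sigma$ if and only if every coinversion of $\mu$ is a coinversion of $\sigma$, where a coinversion of $\sigma$ is a pair $a<b$ such that $b$ appears before $a$ in $\sigma$. Let $\alpha_T$ and $\omega_T$ be the minimum and the maximum of the sylvester class of $T$ for the right weak order. \textbf{Theorem.}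 (1) There is a bijection between the interval-posets of size $n$ and the intervals $[T_1,T_2]$, $T_1\le T_2$, of the Tamari order on planar binary trees with $n$ nodes, such that if $P$ corresponds to $[T_1,T_2]$, then the set of linear extensions of $P$ is the union of the sylvester classes of the trees $T'\in[T_1,T_2]$; moreover $\alpha_{T_1}$ and $\omega_{T_2}$ exist, and this set is the interval $[\alpha_{T_1},\omega_{T_2}]$ of the right weak order. (2) Conversely, interval-posets are the only such labelled posets: a labelled poset on $\{1,\dots,n\}$ is an interval-poset if and only if its set of linear extensions is an interval $[\alpha_{T_1},\omega_{T_2}]$ of the right weak order for some planar binary trees $T_1,T_2$ with $n$ nodes. -/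

import Mathlib

namespace TamariIntervals

/-! ### Planar binary trees and the Tamari order

Planar binary trees are terms of `BinaryTree Unit`; `numNodes` is the size. -/

/-- `RightRotation S T`: the tree `T` is obtained from `S` by one right rotation at some node, that
is, by replacing one subtree `y(x(A, B), C)` by `x(A, y(B, C))`. -/
inductive RightRotation : BinaryTree Unit → BinaryTree Unit → Prop
  | root (A B C : BinaryTree Unit) :
      RightRotation (.node () (.node () A B) C) (.node () A (.node () B C))
  | left {L L' : BinaryTree Unit} (R : BinaryTree Unit) (h : RightRotation L L') :
      RightRotation (.node () L R) (.node () L' R)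
  | right (L : BinaryTree Unit) {R R' : BinaryTree Unit} (h : RightRotation R R') :
      RightRotation (.node () L R) (.node () L R')

theorem RightRotation.numNodes_eq {S T : BinaryTree Unit} (h : RightRotation S T) :
    S.numNodes = T.numNodes := by
  induction h with
  | root A B C => simp only [BinaryTree.numNodes]; omega
  | left R h ih => simp only [BinaryTree.numNodes]; omega
  | right L h ih => simp only [BinaryTree.numNodes]; omega

/-- The sum, over all nodes, of the sizes of the right subtrees. It is used only to see that the
Tamari order is antisymmetric. -/
def rightWeight : BinaryTree Unit → ℕ
  | .nil => 0
  | .node _ l r => rightWeight l + rightWeight r + r.numNodes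

theorem RightRotation.rightWeight_lt {S T : BinaryTree Unit} (h : RightRotation S T) :
    rightWeight S < rightWeight T := by
  induction h with
  | root A B C => simp only [rightWeight, BinaryTree.numNodes]; omega
  | left R h ih => simp only [rightWeight]; omega
  | right L h ih =>
      have := h.numNodes_eq
      simp only [rightWeight]; omega

theorem eq_or_rightWeight_lt {S T : BinaryTree Unit}
    (h : Relation.ReflTransGen RightRotation S T) : S = T ∨ rightWeight S < rightWeight T := by
  induction h with
  | refl => exact Or.inl rfl
  | tail _ h ih =>
      have := h.rightWeight_lt
      rcases ih with rfl | ih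
      · exact Or.inr this
      · exact Or.inr (ih.trans this)

/-- The Tamari order: `S ≤ T` if `T` is obtained from `S` by a finite sequence of right
rotations. -/
instance tamariOrder : PartialOrder (BinaryTree Unit) where
  le S T := Relation.ReflTransGen RightRotation S T
  le_refl _ := Relation.ReflTransGen.refl
  le_trans _ _ _ h h' := Relation.ReflTransGen.trans h h'
  le_antisymm S T h h' := by
    rcases eq_or_rightWeight_lt h with h | h
    · exact h
    · rcases eq_or_rightWeight_lt h' with h' | h'
      · exact h'.symm
      · omega

/-- Planar binary trees of size `n`, with the (induced) Tamari order. -/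
abbrev TreeOfSize (n : ℕ) : Type := {T : BinaryTree Unit // T.numNodes = n}

/-! ### Labelled posets and linear extensions

The set of labels `{1, …, n}` with its natural order is represented by `Fin n`, that is,
`{0, …, n - 1}`. -/

/-- A poset structure on the set of labels; `P.rel a b` is to be read `a ⊲ b`. -/
@[ext]
structure LabelledPoset (n : ℕ) where
  rel : Fin n → Fin n → Prop
  refl : ∀ a, rel a a
  antisymm : ∀ a b, rel a b → rel b a → a = b
  trans : ∀ a b c, rel a b → rel b c → rel a c

/-- The two conditions that define interval-posets. -/
def LabelledPoset.IsIntervalPoset {n : ℕ} (P : LabelledPoset n) : Prop :=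
  (∀ a c, P.rel a c → a < c → ∀ b, a < b → b < c → P.rel b c) ∧
  (∀ a c, P.rel c a → a < c → ∀ b, a < b → b < c → P.rel b a)

/-- Permutations are words `σ 0, σ 1, …, σ (n - 1)`, so that the label `a` is at position
`σ.symm a`. The linear extensions of a poset relation are the permutations in which `a` is before
`b` whenever `a ⊲ b` (and `a ≠ b`). -/
def linearExtensions {n : ℕ} (rel : Fin n → Fin n → Prop) : Set (Equiv.Perm (Fin n)) :=
  {σ | ∀ a b, rel a b → σ.symm a ≤ σ.symm b}

/-! ### The right weak order -/

/-- The coinversions of `σ`: the pairs of labels `a < b` such that `b` is before `a` in `σ`. -/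
def coinversions {n : ℕ} (σ : Equiv.Perm (Fin n)) : Set (Fin n × Fin n) :=
  {p | p.1 < p.2 ∧ σ.symm p.2 < σ.symm p.1}

theorem coinversions_injective {n : ℕ} :
    Function.Injective (coinversions : Equiv.Perm (Fin n) → Set (Fin n × Fin n)) := by
  intro σ τ h
  have key : ∀ a b, a < b → (σ.symm b < σ.symm a ↔ τ.symm b < τ.symm a) := by
    intro a b hab
    have := Set.ext_iff.mp h (a, b)
    simpa [coinversions, hab] using this
  have lt : ∀ a b, σ.symm a < σ.symm b → τ.symm a < τ.symm b := by
    intro a b hab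
    rcases lt_trichotomy a b with h1 | h1 | h1
    · have h2 : ¬ τ.symm b < τ.symm a := fun h3 => absurd ((key a b h1).mpr h3) hab.asymm
      exact lt_of_le_of_ne (not_lt.mp h2) fun h3 => h1.ne (τ.symm.injective h3)
    · exact absurd hab (by simp [h1])
    · exact (key b a h1).mp hab
  have mono : StrictMono (fun i => τ.symm (σ i)) := by
    intro i j hij
    exact lt _ _ (by simpa using hij)
  have hid : (fun i => τ.symm (σ i)) = id :=
    Set.range_injOn_strictMono mono strictMono_id
      (by rw [Set.range_id]; exact ((σ.trans τ.symm).surjective).range_eq)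
  ext i
  have := congrFun hid i
  simp only [id] at this
  rw [Equiv.symm_apply_eq] at this
  rw [this]

/-- The right weak order on permutations: inclusion of the sets of coinversions. -/
instance weakOrder (n : ℕ) : PartialOrder (Equiv.Perm (Fin n)) :=
  PartialOrder.lift coinversions coinversions_injective

/-! ### Binary search trees and sylvester classes -/

/-- The binary search tree labelling of a binary tree by consecutive integers, the smallest of
which is `k`: the node gets the label that is larger than those of its left subtree and smaller
than those of its right subtree. -/
def bstLabelling : ℕ → BinaryTree Unit → BinaryTree ℕ
  | _, .nil => .nil
  | k, .node _ l r =>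
      .node (k + l.numNodes) (bstLabelling k l) (bstLabelling (k + l.numNodes + 1) r)

/-- `x` is a label of the tree. -/
def IsLabel (x : ℕ) : BinaryTree ℕ → Prop
  | .nil => False
  | .node v l r => x = v ∨ IsLabel x l ∨ IsLabel x r

/-- `x` is in the subtree whose root is `y`. -/
def InSubtreeOf (x y : ℕ) : BinaryTree ℕ → Prop
  | .nil => False
  | .node v l r => (y = v ∧ IsLabel x (.node v l r)) ∨ InSubtreeOf x y l ∨ InSubtreeOf x y r

/-- The order relation `⊲` on labels given by (the binary search tree labelling of) `T`. -/
def treeRel {n : ℕ} (T : TreeOfSize n) (a b : Fin n) : Prop :=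
  InSubtreeOf a b (bstLabelling 0 T.1)

/-- The sylvester class of a tree: the set of its linear extensions. -/
def sylvesterClass {n : ℕ} (T : TreeOfSize n) : Set (Equiv.Perm (Fin n)) :=
  linearExtensions (treeRel T)

end TamariIntervals

namespace TamariIntervals

/-! ### The subtree relation of a binary search tree -/

/-! Split a labelled poset into decreasing relations `b ⊲ a` and increasing relations `a ⊲ b`, where
`a < b`. For trees, either half determines the tree: the Tamari order is inclusion of decreasing
relations (`le_iff_decLE`) and reverse inclusion of increasing ones (`le_iff_incLE`).

For an interval-poset `P`, the decreasing relations form the coinversion set of a permutation `α`,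
and the complement of the increasing ones that of some `ω`; the linear extensions of `P` are then
exactly `[α, ω]`. Every permutation lies in a sylvester class, and a tree sharing a linear extension
with `P` contains `P` (`decLE_incLE_of_mem`). Hence the tree `S` of `α` has the decreasing relations
of `P`, the tree `T` of `ω` its increasing ones, and the trees of all linear extensions lie in `[S,
T]`. This is the bijection (`Encodes`).

The converse uses that a poset is recovered from its linear extensions
(`rel_of_forall_linearExtensions`). -/

theorem isLabel_bstLabelling (T : BinaryTree Unit) (k x : ℕ) :
    IsLabel x (bstLabelling k T) ↔ k ≤ x ∧ x < k + T.numNodes := by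
  induction T generalizing k with
  | nil => exact iff_of_false id fun h => by simp only [BinaryTree.numNodes] at h; omega
  | node _ l r ihl ihr =>
    simp only [bstLabelling, IsLabel, BinaryTree.numNodes, ihl, ihr]; omega

/-- `x` is in the subtree rooted at `y` when the nodes of `T` are labelled from `k` on. -/
def SubRel (k : ℕ) (T : BinaryTree Unit) (x y : ℕ) : Prop :=
  InSubtreeOf x y (bstLabelling k T)

theorem subRel_nil {k x y : ℕ} : SubRel k .nil x y ↔ False := Iff.rfl

theorem subRel_node {k x y : ℕ} {u : Unit} {l r : BinaryTree Unit} :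
    SubRel k (.node u l r) x y ↔
      (y = k + l.numNodes ∧ k ≤ x ∧ x < k + (l.numNodes + r.numNodes + 1)) ∨
        SubRel k l x y ∨ SubRel (k + l.numNodes + 1) r x y := by
  have h := isLabel_bstLabelling (.node u l r) k x
  simp only [bstLabelling, BinaryTree.numNodes] at h
  simp only [SubRel, bstLabelling, InSubtreeOf, h]

theorem SubRel.bounds {k x y : ℕ} {T : BinaryTree Unit} (h : SubRel k T x y) :
    k ≤ x ∧ x < k + T.numNodes ∧ k ≤ y ∧ y < k + T.numNodes := by
  induction T generalizing k with
  | nil => exact (subRel_nil.mp h).elim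
  | node _ l r ihl ihr =>
    simp only [BinaryTree.numNodes]
    rcases subRel_node.mp h with h | h | h
    · omega
    · have := ihl h; omega
    · have := ihr h; omega

theorem SubRel.refl {k x : ℕ} {T : BinaryTree Unit} (h : k ≤ x) (h' : x < k + T.numNodes) :
    SubRel k T x x := by
  induction T generalizing k with
  | nil => simp only [BinaryTree.numNodes] at h'; omega
  | node _ l r ihl ihr =>
    simp only [BinaryTree.numNodes] at h'
    rw [subRel_node]
    rcases lt_trichotomy x (k + l.numNodes) with hx | hx | hx
    · exact Or.inr (Or.inl (ihl h hx))
    · exact Or.inl ⟨hx, h, by omega⟩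
    · exact Or.inr (Or.inr (ihr (by omega) (by omega)))

theorem SubRel.antisymm {k x y : ℕ} {T : BinaryTree Unit} (h : SubRel k T x y)
    (h' : SubRel k T y x) : x = y := by
  induction T generalizing k with
  | nil => exact (subRel_nil.mp h).elim
  | node _ l r ihl ihr =>
    rcases subRel_node.mp h with h | h | h <;> rcases subRel_node.mp h' with h' | h' | h'
    · omega
    · have := h'.bounds; omega
    · have := h'.bounds; omega
    · have := h.bounds; omega
    · exact ihl h h'
    · have := h.bounds; have := h'.bounds; omega
    · have := h.bounds; omega
    · have := h.bounds; have := h'.bounds; omega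
    · exact ihr h h'

theorem SubRel.trans {k x y z : ℕ} {T : BinaryTree Unit} (h : SubRel k T x y)
    (h' : SubRel k T y z) : SubRel k T x z := by
  induction T generalizing k with
  | nil => exact (subRel_nil.mp h).elim
  | node _ l r ihl ihr =>
    have hb := h.bounds
    simp only [BinaryTree.numNodes] at hb
    rcases subRel_node.mp h' with h' | h' | h'
    · exact subRel_node.mpr (Or.inl ⟨h'.1, by omega, by omega⟩)
    · have := h'.bounds
      rcases subRel_node.mp h with h | h | h
      · omega
      · exact subRel_node.mpr (Or.inr (Or.inl (ihl h h')))
      · have := h.bounds; omega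
    · have := h'.bounds
      rcases subRel_node.mp h with h | h | h
      · omega
      · have := h.bounds; omega
      · exact subRel_node.mpr (Or.inr (Or.inr (ihr h h')))

theorem SubRel.between {k a b c : ℕ} {T : BinaryTree Unit} (h : SubRel k T a c)
    (hb : a ≤ b ∧ b ≤ c ∨ c ≤ b ∧ b ≤ a) : SubRel k T b c := by
  induction T generalizing k with
  | nil => exact (subRel_nil.mp h).elim
  | node _ l r ihl ihr =>
    rw [subRel_node]
    rcases subRel_node.mp h with h | h | h
    · exact Or.inl ⟨h.1, by omega, by omega⟩
    · exact Or.inr (Or.inl (ihl h))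
    · exact Or.inr (Or.inr (ihr h))

/-- Two labels have a common ancestor that lies between them. -/
theorem exists_common_ancestor {k a b : ℕ} {T : BinaryTree Unit} (ha : k ≤ a) (hab : a ≤ b)
    (hb : b < k + T.numNodes) : ∃ c, a ≤ c ∧ c ≤ b ∧ SubRel k T a c ∧ SubRel k T b c := by
  induction T generalizing k with
  | nil => simp only [BinaryTree.numNodes] at hb; omega
  | node _ l r ihl ihr =>
    simp only [BinaryTree.numNodes] at hb
    simp only [subRel_node]
    by_cases h1 : b < k + l.numNodes
    · obtain ⟨c, h⟩ := ihl ha h1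
      exact ⟨c, h.1, h.2.1, Or.inr (Or.inl h.2.2.1), Or.inr (Or.inl h.2.2.2)⟩
    · by_cases h2 : k + l.numNodes < a
      · obtain ⟨c, h⟩ := ihr (k := k + l.numNodes + 1) (by omega) (by omega)
        exact ⟨c, h.1, h.2.1, Or.inr (Or.inr h.2.2.1), Or.inr (Or.inr h.2.2.2)⟩
      · exact ⟨k + l.numNodes, by omega, by omega, Or.inl ⟨rfl, by omega, by omega⟩,
          Or.inl ⟨rfl, by omega, by omega⟩⟩

/-- Every priority function is compatible with some tree. -/
theorem exists_tree_monotone (f : ℕ → ℕ) (m k : ℕ) :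
    ∃ T : BinaryTree Unit, T.numNodes = m ∧ ∀ x y, SubRel k T x y → f x ≤ f y := by
  induction m using Nat.strong_induction_on generalizing k with
  | _ m ih =>
    rcases Nat.eq_zero_or_pos m with rfl | hm
    · exact ⟨.nil, rfl, fun x y h => (subRel_nil.mp h).elim⟩
    -- The label of highest priority becomes the root.
    · obtain ⟨r, hr, hmax⟩ := Finset.exists_max_image (Finset.Ico k (k + m)) f
        ⟨k, by simp only [Finset.mem_Ico]; omega⟩
      simp only [Finset.mem_Ico] at hr hmax
      obtain ⟨A, hA, hA'⟩ := ih (r - k) (by omega) k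
      obtain ⟨B, hB, hB'⟩ := ih (k + m - r - 1) (by omega) (r + 1)
      refine ⟨.node () A B, by simp only [BinaryTree.numNodes]; omega, fun x y h => ?_⟩
      have hr' : k + A.numNodes = r := by omega
      rw [subRel_node, hr'] at h
      rcases h with ⟨rfl, h⟩ | h | h
      · exact hmax x (by omega)
      · exact hA' _ _ h
      · exact hB' _ _ h

/-! ### The Tamari order in terms of the subtree relation -/

theorem le_node {S S' T T' : BinaryTree Unit} (h : S ≤ S') (h' : T ≤ T') :
    BinaryTree.node () S T ≤ BinaryTree.node () S' T' := by
  have h1 : BinaryTree.node () S T ≤ BinaryTree.node () S' T :=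
    Relation.ReflTransGen.lift (fun L => BinaryTree.node () L T)
      (fun _ _ h => RightRotation.left T h) _ _ h
  have h2 : BinaryTree.node () S' T ≤ BinaryTree.node () S' T' :=
    Relation.ReflTransGen.lift (fun R => BinaryTree.node () S' R)
      (fun _ _ h => RightRotation.right S' h) _ _ h'
  exact h1.trans h2

theorem numNodes_eq_of_le {S T : BinaryTree Unit} (h : S ≤ T) : S.numNodes = T.numNodes := by
  change Relation.ReflTransGen RightRotation S T at h
  induction h with
  | refl => rfl
  | tail _ h ih => exact ih.trans h.numNodes_eq

/-- Rotating `y(x(A, B), C)` puts `y` and `C` below `x`, which is decreasing, and removes `x` and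
`A` from below `y`, which is increasing. Nothing else changes. -/
theorem RightRotation.subRel {S T : BinaryTree Unit} (h : RightRotation S T) (k a b : ℕ)
    (hab : a < b) :
    (SubRel k S b a → SubRel k T b a) ∧ (SubRel k T a b → SubRel k S a b) := by
  induction h generalizing k with
  | root A B C =>
    have e : k + (A.numNodes + B.numNodes + 1) + 1 = k + A.numNodes + 1 + B.numNodes + 1 := by
      omega
    simp only [subRel_node, BinaryTree.numNodes, e]
    constructor
    · rintro (h | (h | h | h) | h)
      · exact Or.inr (Or.inr (Or.inl ⟨by omega, by omega, by omega⟩))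
      · exact Or.inl ⟨by omega, by omega, by omega⟩
      · exact Or.inr (Or.inl h)
      · exact Or.inr (Or.inr (Or.inr (Or.inl h)))
      · exact Or.inr (Or.inr (Or.inr (Or.inr h)))
    · rintro (h | h | h | h | h)
      · exact Or.inr (Or.inl (Or.inl ⟨by omega, by omega, by omega⟩))
      · exact Or.inr (Or.inl (Or.inr (Or.inl h)))
      · exact Or.inl ⟨by omega, by omega, by omega⟩
      · exact Or.inr (Or.inl (Or.inr (Or.inr h)))
      · exact Or.inr (Or.inr h)
  | left R h ih =>
    have := ih k
    simp only [subRel_node, h.numNodes_eq]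
    tauto
  | @right L R R' h ih =>
    have := ih (k + L.numNodes + 1)
    simp only [subRel_node, h.numNodes_eq]
    tauto

theorem subRel_of_le {S T : BinaryTree Unit} (h : S ≤ T) (k a b : ℕ) (hab : a < b) :
    (SubRel k S b a → SubRel k T b a) ∧ (SubRel k T a b → SubRel k S a b) := by
  change Relation.ReflTransGen RightRotation S T at h
  induction h with
  | refl => exact ⟨id, id⟩
  | tail _ h ih =>
    have := h.subRel k a b hab
    tauto

/-- A node on the left branch can be brought to the root by right rotations. -/
theorem exists_le_node {S : BinaryTree Unit} {k r : ℕ} (hk : k ≤ r) (hr : r < k + S.numNodes)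
    (h : ∀ x, x < r → ¬ SubRel k S r x) :
    ∃ A B : BinaryTree Unit, k + A.numNodes = r ∧ S ≤ .node () A B ∧
      (∀ a b, a < b → SubRel k A b a → SubRel k S b a) ∧
      (∀ a b, a < b → SubRel (r + 1) B b a → SubRel k S b a) := by
  induction S with
  | nil => simp only [BinaryTree.numNodes] at hr; omega
  | node u L R ihL _ =>
    simp only [BinaryTree.numNodes] at hr
    rcases lt_trichotomy r (k + L.numNodes) with hx | hx | hx
    · obtain ⟨A, B, hA, hle, h1, h2⟩ :=
        ihL hx (fun x hxr hs => h x hxr (subRel_node.mpr (Or.inr (Or.inl hs))))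
      have hn := numNodes_eq_of_le hle
      simp only [BinaryTree.numNodes] at hn
      refine ⟨A, .node () B R, hA, ?_, ?_, ?_⟩
      · exact (le_node hle le_rfl).trans (Relation.ReflTransGen.single (.root A B R))
      · exact fun a b hab hs => subRel_node.mpr (Or.inr (Or.inl (h1 a b hab hs)))
      · intro a b hab hs
        have e : r + 1 + B.numNodes = k + L.numNodes := by omega
        rw [subRel_node, e] at hs
        rw [subRel_node]
        rcases hs with hs | hs | hs
        · exact Or.inl ⟨hs.1, by omega, by omega⟩
        · exact Or.inr (Or.inl (h2 a b hab hs))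
        · exact Or.inr (Or.inr hs)
    · refine ⟨L, R, hx.symm, le_rfl, fun a b _ hs => subRel_node.mpr (Or.inr (Or.inl hs)),
        fun a b _ hs => subRel_node.mpr (Or.inr (Or.inr (hx ▸ hs)))⟩
    -- A label in the right subtree lies below the smaller root, which `h` forbids.
    · exact absurd (subRel_node.mpr (Or.inl ⟨rfl, by omega, by omega⟩)) (h _ hx)

/-- The root of `T` is below no smaller label in `S`, as that relation would pass to `T`; so it can
be rotated to the root of `S`. The new subtrees have no new decreasing relations, so the induction
applies to both. -/
theorem le_of_subRel {S T : BinaryTree Unit} {k : ℕ} (hn : S.numNodes = T.numNodes)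
    (h : ∀ a b, a < b → SubRel k S b a → SubRel k T b a) : S ≤ T := by
  induction T generalizing S k with
  | nil =>
    cases S with
    | nil => exact le_rfl
    | node _ l r => simp only [BinaryTree.numNodes] at hn; omega
  | node _ L R ihL ihR =>
    have hn' := hn
    simp only [BinaryTree.numNodes] at hn'
    obtain ⟨A, B, hA, hle, h1, h2⟩ :=
      exists_le_node (S := S) (k := k) (r := k + L.numNodes) (by omega) (by omega) (by
        intro x hx hs
        rcases subRel_node.mp (h x _ hx hs) with h | h | h
        · omega
        · have := h.bounds; omega
        · have := h.bounds; omega)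
    have hm := numNodes_eq_of_le hle
    simp only [BinaryTree.numNodes] at hm
    refine hle.trans (le_node (ihL (k := k) (by omega) ?_)
      (ihR (k := k + L.numNodes + 1) (by omega) ?_))
    · intro a b hab hs
      have hb := hs.bounds
      rcases subRel_node.mp (h a b hab (h1 a b hab hs)) with h | h | h
      · omega
      · exact h
      · have := h.bounds; omega
    · intro a b hab hs
      have hb := hs.bounds
      rcases subRel_node.mp (h a b hab (h2 a b hab hs)) with h | h | h
      · omega
      · have := h.bounds; omega
      · exact h

/-! ### Trees as interval-posets -/

variable {n : ℕ}

/-- The interval-poset given by the binary search tree labelling of a tree. -/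
def treePoset (T : TreeOfSize n) : LabelledPoset n where
  rel := treeRel T
  refl a := SubRel.refl (Nat.zero_le _) (by rw [T.2, Nat.zero_add]; exact a.2)
  antisymm _ _ h h' := Fin.ext (SubRel.antisymm h h')
  trans _ _ _ h h' := SubRel.trans h h'

theorem treePoset_isIntervalPoset (T : TreeOfSize n) : (treePoset T).IsIntervalPoset :=
  ⟨fun _ _ h _ _ hab hbc => SubRel.between h (Or.inl ⟨hab.le, hbc.le⟩),
    fun _ _ h _ _ hab hbc => SubRel.between h (Or.inr ⟨hab.le, hbc.le⟩)⟩

theorem exists_treeRel_both (T : TreeOfSize n) {a b : Fin n} (hab : a ≤ b) :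
    ∃ c, a ≤ c ∧ c ≤ b ∧ treeRel T a c ∧ treeRel T b c := by
  obtain ⟨c, h1, h2, h3, h4⟩ := exists_common_ancestor (T := T.1) (Nat.zero_le a.1) hab
    (by rw [T.2, Nat.zero_add]; exact b.2)
  exact ⟨⟨c, h2.trans_lt b.2⟩, h1, h2, h3, h4⟩

/-- The decreasing relations of `P` hold in `Q`. -/
def DecLE (P Q : LabelledPoset n) : Prop := ∀ a b, a < b → P.rel b a → Q.rel b a

/-- The increasing relations of `P` hold in `Q`. -/
def IncLE (P Q : LabelledPoset n) : Prop := ∀ a b, a < b → P.rel a b → Q.rel a b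

/-- In `T`, take a common ancestor `c` of `a` and `b` between them. If `c ≠ a`, the interval
condition gives `c ⊲ a` in `P`, against `a ⊲ c` in `T`; so `c = a`. -/
theorem decLE_treePoset {P : LabelledPoset n} (hP : P.IsIntervalPoset) (T : TreeOfSize n)
    (h : ∀ a c, a < c → P.rel c a → ¬ treeRel T a c) : DecLE P (treePoset T) := by
  intro a b hab hba
  obtain ⟨c, hac, hcb, h1, h2⟩ := exists_treeRel_both T hab.le
  rcases hac.eq_or_lt with rfl | hac
  · exact h2
  · refine absurd h1 (h a c hac ?_)
    rcases hcb.eq_or_lt with rfl | hcb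
    · exact hba
    · exact hP.2 a b hba hab c hac hcb

theorem incLE_treePoset {P : LabelledPoset n} (hP : P.IsIntervalPoset) (T : TreeOfSize n)
    (h : ∀ a c, a < c → P.rel a c → ¬ treeRel T c a) : IncLE P (treePoset T) := by
  intro a b hab hba
  obtain ⟨c, hac, hcb, h1, h2⟩ := exists_treeRel_both T hab.le
  rcases hcb.eq_or_lt with rfl | hcb
  · exact h1
  · refine absurd h2 (h c b hcb ?_)
    rcases hac.eq_or_lt with rfl | hac
    · exact hba
    · exact hP.1 a b hba hab c hac hcb

theorem le_iff_decLE {S T : TreeOfSize n} : S ≤ T ↔ DecLE (treePoset S) (treePoset T) := by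
  refine ⟨fun h a b hab => (subRel_of_le (show S.1 ≤ T.1 from h) 0 a b hab).1, fun h => ?_⟩
  refine le_of_subRel (k := 0) (S.2.trans T.2.symm) fun a b hab hs => ?_
  have hb := hs.bounds
  rw [S.2] at hb
  exact h ⟨a, by omega⟩ ⟨b, by omega⟩ hab hs

theorem le_iff_incLE {S T : TreeOfSize n} : S ≤ T ↔ IncLE (treePoset T) (treePoset S) := by
  refine ⟨fun h a b hab => (subRel_of_le (show S.1 ≤ T.1 from h) 0 a b hab).2, fun h => ?_⟩
  -- An increasing relation of `T` holds in `S`, so it cannot contradict a decreasing one of `S`.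
  exact le_iff_decLE.mpr <| decLE_treePoset (treePoset_isIntervalPoset S) T
    fun a c hac hca hac' => hac.ne ((treePoset S).antisymm a c (h a c hac hac') hca)

/-! ### Linear extensions and coinversions -/

theorem not_lt_symm {σ : Equiv.Perm (Fin n)} {a b : Fin n} (hab : a < b)
    (h : (a, b) ∉ coinversions σ) : σ.symm a < σ.symm b :=
  lt_of_le_of_ne (not_lt.mp fun h' => h ⟨hab, h'⟩) fun h' => hab.ne (σ.symm.injective h')

theorem mem_linearExtensions {P : LabelledPoset n} {σ : Equiv.Perm (Fin n)} :
    σ ∈ linearExtensions P.rel ↔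
      (∀ a b, a < b → P.rel b a → (a, b) ∈ coinversions σ) ∧
      (∀ a b, a < b → P.rel a b → (a, b) ∉ coinversions σ) := by
  constructor
  · exact fun h => ⟨fun a b hab hr => ⟨hab, lt_of_le_of_ne (h b a hr)
      fun h' => hab.ne' (σ.symm.injective h')⟩, fun a b _ hr hc => (h a b hr).not_gt hc.2⟩
  · rintro ⟨h1, h2⟩ a b hr
    rcases lt_trichotomy a b with hab | rfl | hab
    · exact (not_lt_symm hab (h2 a b hab hr)).le
    · exact le_rfl
    · exact (h1 b a hab hr).2.le

/-- Every strict linear order on the labels is given by a permutation. -/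
theorem exists_perm_of_strictTotal (r : Fin n → Fin n → Prop) (irr : ∀ a, ¬ r a a)
    (tr : ∀ a b c, r a b → r b c → r a c) (tot : ∀ a b, a ≠ b → r a b ∨ r b a) :
    ∃ σ : Equiv.Perm (Fin n), ∀ a b, σ.symm a < σ.symm b ↔ r a b := by
  classical
  let s (a : Fin n) : Finset (Fin n) := Finset.univ.filter fun b => r b a
  have hs (a : Fin n) : (s a).card < n := by
    have : (s a).card < (Finset.univ : Finset (Fin n)).card :=
      Finset.card_lt_card (Finset.ssubset_univ_iff.mpr fun h =>
        irr a (Finset.mem_filter.mp (h ▸ Finset.mem_univ a : a ∈ s a)).2)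
    simpa using this
  -- The position of a label is the number of its predecessors.
  let f (a : Fin n) : Fin n := ⟨(s a).card, hs a⟩
  have hf : ∀ a b, r a b → f a < f b := by
    intro a b hab
    refine show (s a).card < (s b).card from
      Finset.card_lt_card ((Finset.ssubset_iff_of_subset ?_).mpr ⟨a, ?_, ?_⟩)
    · intro x hx
      simp only [s, Finset.mem_filter, Finset.mem_univ, true_and] at hx ⊢
      exact tr _ _ _ hx hab
    · simpa [s] using hab
    · simpa [s] using irr a
  have hinj : Function.Injective f := by
    intro a b hab
    by_contra hne
    rcases tot a b hne with h | h
    · exact (hf a b h).ne hab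
    · exact (hf b a h).ne hab.symm
  refine ⟨(Equiv.ofBijective f (Finite.injective_iff_bijective.mp hinj)).symm, fun a b => ?_⟩
  simp only [Equiv.symm_symm, Equiv.ofBijective_apply]
  refine ⟨fun h => ?_, hf a b⟩
  by_contra hr
  rcases eq_or_ne a b with rfl | hne
  · exact lt_irrefl _ h
  · exact (hf b a ((tot a b hne).resolve_left hr)).asymm h

/-- Sets of pairs that are transitive with transitive complement are coinversion sets. -/
theorem exists_perm_coinversions (d : Fin n → Fin n → Prop)
    (h1 : ∀ a b c, a < b → b < c → d a b → d b c → d a c)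
    (h2 : ∀ a b c, a < b → b < c → d a c → d a b ∨ d b c) :
    ∃ σ : Equiv.Perm (Fin n), ∀ a b, (a, b) ∈ coinversions σ ↔ a < b ∧ d a b := by
  obtain ⟨σ, hσ⟩ := exists_perm_of_strictTotal
    -- The natural order with the pairs of `d` reversed; `h1` and `h2` make it transitive.
    (fun a b => (a < b ∧ ¬ d a b) ∨ (b < a ∧ d b a)) (by simp) (by grind) (by grind)
  refine ⟨σ, fun a b => ?_⟩
  simp only [coinversions, Set.mem_ofPred_eq, hσ]
  grind

/-- Transitivity of `P` gives the first closure condition and the interval condition the second; in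
`exists_perm_inc` the roles are exchanged. -/
theorem exists_perm_dec {P : LabelledPoset n} (hP : P.IsIntervalPoset) :
    ∃ σ : Equiv.Perm (Fin n), ∀ a b, (a, b) ∈ coinversions σ ↔ a < b ∧ P.rel b a :=
  exists_perm_coinversions _ (fun _ _ _ _ _ h h' => P.trans _ _ _ h' h)
    fun a b c hab hbc h => Or.inl (hP.2 a c h (hab.trans hbc) b hab hbc)

theorem exists_perm_inc {P : LabelledPoset n} (hP : P.IsIntervalPoset) :
    ∃ σ : Equiv.Perm (Fin n), ∀ a b, (a, b) ∈ coinversions σ ↔ a < b ∧ ¬ P.rel a b :=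
  exists_perm_coinversions _
    (fun a b c hab hbc _ h' h => h' (hP.1 a c h (hab.trans hbc) b hab hbc))
    fun a b c _ _ h => by
      by_contra! hc
      exact h (P.trans _ _ _ hc.1 hc.2)

theorem weakOrder_le_iff {σ τ : Equiv.Perm (Fin n)} :
    σ ≤ τ ↔ ∀ a b, (a, b) ∈ coinversions σ → (a, b) ∈ coinversions τ :=
  ⟨fun h _ _ hab => h hab, fun h p => h p.1 p.2⟩

theorem isLeast_of_coinversions {P : LabelledPoset n} {α : Equiv.Perm (Fin n)}
    (h : ∀ a b, (a, b) ∈ coinversions α ↔ a < b ∧ P.rel b a) :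
    IsLeast (linearExtensions P.rel) α := by
  refine ⟨mem_linearExtensions.mpr ⟨fun a b hab hr => (h a b).mpr ⟨hab, hr⟩,
    fun a b hab hr hc => hab.ne (P.antisymm _ _ hr ((h a b).mp hc).2)⟩, fun σ hσ => ?_⟩
  exact weakOrder_le_iff.mpr fun a b hab =>
    (mem_linearExtensions.mp hσ).1 a b ((h a b).mp hab).1 ((h a b).mp hab).2

theorem isGreatest_of_coinversions {P : LabelledPoset n} {ω : Equiv.Perm (Fin n)}
    (h : ∀ a b, (a, b) ∈ coinversions ω ↔ a < b ∧ ¬ P.rel a b) :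
    IsGreatest (linearExtensions P.rel) ω := by
  refine ⟨mem_linearExtensions.mpr ⟨fun a b hab hr => (h a b).mpr ⟨hab, fun hr' =>
    hab.ne (P.antisymm _ _ hr' hr)⟩, fun a b hab hr hc => ((h a b).mp hc).2 hr⟩, fun σ hσ => ?_⟩
  exact weakOrder_le_iff.mpr fun a b hab => (h a b).mpr
    ⟨hab.1, fun hr => (mem_linearExtensions.mp hσ).2 a b hab.1 hr hab⟩

theorem linearExtensions_eq_Icc {P : LabelledPoset n} {α ω : Equiv.Perm (Fin n)}
    (hα : ∀ a b, (a, b) ∈ coinversions α ↔ a < b ∧ P.rel b a)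
    (hω : ∀ a b, (a, b) ∈ coinversions ω ↔ a < b ∧ ¬ P.rel a b) :
    linearExtensions P.rel = Set.Icc α ω := by
  ext σ
  refine ⟨fun h => ⟨(isLeast_of_coinversions hα).2 h, (isGreatest_of_coinversions hω).2 h⟩,
    fun h => mem_linearExtensions.mpr ⟨fun a b hab hr => ?_, fun a b hab hr hc => ?_⟩⟩
  · exact weakOrder_le_iff.mp h.1 a b ((hα a b).mpr ⟨hab, hr⟩)
  · exact ((hω a b).mp (weakOrder_le_iff.mp h.2 a b hc)).2 hr

theorem coinversions_of_isLeast {P : LabelledPoset n} (hP : P.IsIntervalPoset)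
    {α : Equiv.Perm (Fin n)} (hα : IsLeast (linearExtensions P.rel) α) (a b : Fin n) :
    (a, b) ∈ coinversions α ↔ a < b ∧ P.rel b a := by
  obtain ⟨σ, hσ⟩ := exists_perm_dec hP
  rw [hα.unique (isLeast_of_coinversions hσ), hσ]

theorem coinversions_of_isGreatest {P : LabelledPoset n} (hP : P.IsIntervalPoset)
    {ω : Equiv.Perm (Fin n)} (hω : IsGreatest (linearExtensions P.rel) ω) (a b : Fin n) :
    (a, b) ∈ coinversions ω ↔ a < b ∧ ¬ P.rel a b := by
  obtain ⟨σ, hσ⟩ := exists_perm_inc hP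
  rw [hω.unique (isGreatest_of_coinversions hσ), hσ]

theorem exists_mem_sylvesterClass (σ : Equiv.Perm (Fin n)) :
    ∃ T : TreeOfSize n, σ ∈ sylvesterClass T := by
  obtain ⟨T, hT, h⟩ := exists_tree_monotone
    -- The priority is the position in the word; the value 0 is never used, as all labels are below
    -- `n`.
    (fun x => if hx : x < n then (σ.symm ⟨x, hx⟩).1 else 0) n 0
  refine ⟨⟨T, hT⟩, fun a b hab => ?_⟩
  simpa using h a b hab

/-- If an interval-poset shares a linear extension with a tree, then its relations between distinct
labels hold in the tree. -/
theorem decLE_incLE_of_mem {P : LabelledPoset n} (hP : P.IsIntervalPoset) {T : TreeOfSize n}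
    {σ : Equiv.Perm (Fin n)} (h : σ ∈ linearExtensions P.rel) (hT : σ ∈ sylvesterClass T) :
    DecLE P (treePoset T) ∧ IncLE P (treePoset T) :=
  ⟨decLE_treePoset hP T fun a c hac hr ht =>
      hac.ne (σ.symm.injective (le_antisymm (hT a c ht) (h c a hr))),
    incLE_treePoset hP T fun a c hac hr ht =>
      hac.ne (σ.symm.injective (le_antisymm (h a c hr) (hT c a ht)))⟩

/-! ### Interval-posets and Tamari intervals -/

/-- `P` has the decreasing relations of `S` and the increasing relations of `T`. -/
def Encodes (P : LabelledPoset n) (S T : TreeOfSize n) : Prop :=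
  (∀ a b, a < b → (P.rel b a ↔ treeRel S b a)) ∧ (∀ a b, a < b → (P.rel a b ↔ treeRel T a b))

theorem exists_encodes {P : LabelledPoset n} (hP : P.IsIntervalPoset) :
    ∃ S T : TreeOfSize n, S ≤ T ∧ Encodes P S T := by
  obtain ⟨α, hα⟩ := exists_perm_dec hP
  obtain ⟨ω, hω⟩ := exists_perm_inc hP
  obtain ⟨S, hS⟩ := exists_mem_sylvesterClass α
  obtain ⟨T, hT⟩ := exists_mem_sylvesterClass ω
  have h1 := decLE_incLE_of_mem hP (isLeast_of_coinversions hα).1 hS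
  have h2 := decLE_incLE_of_mem hP (isGreatest_of_coinversions hω).1 hT
  have hS' := mem_linearExtensions (P := treePoset S).mp hS
  have hT' := mem_linearExtensions (P := treePoset T).mp hT
  have e1 : ∀ a b, a < b → (P.rel b a ↔ treeRel S b a) := fun a b hab =>
    ⟨h1.1 a b hab, fun h => ((hα a b).mp (hS'.1 a b hab h)).2⟩
  have e2 : ∀ a b, a < b → (P.rel a b ↔ treeRel T a b) := fun a b hab =>
    ⟨h2.2 a b hab, fun h => by
      by_contra hr
      exact hT'.2 a b hab h ((hω a b).mpr ⟨hab, hr⟩)⟩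
  exact ⟨S, T, le_iff_decLE.mpr fun a b hab h => h2.1 a b hab ((e1 a b hab).mpr h), e1, e2⟩

theorem Encodes.unique {P : LabelledPoset n} {S T S' T' : TreeOfSize n} (h : Encodes P S T)
    (h' : Encodes P S' T') : S = S' ∧ T = T' := by
  refine ⟨le_antisymm (le_iff_decLE.mpr fun a b hab hr => ?_)
    (le_iff_decLE.mpr fun a b hab hr => ?_), le_antisymm (le_iff_incLE.mpr fun a b hab hr => ?_)
    (le_iff_incLE.mpr fun a b hab hr => ?_)⟩
  · exact (h'.1 a b hab).mp ((h.1 a b hab).mpr hr)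
  · exact (h.1 a b hab).mp ((h'.1 a b hab).mpr hr)
  · exact (h.2 a b hab).mp ((h'.2 a b hab).mpr hr)
  · exact (h'.2 a b hab).mp ((h.2 a b hab).mpr hr)

theorem Encodes.poset_unique {P Q : LabelledPoset n} {S T : TreeOfSize n} (h : Encodes P S T)
    (h' : Encodes Q S T) : P = Q := by
  ext a b
  rcases lt_trichotomy a b with hab | rfl | hab
  · rw [h.2 a b hab, h'.2 a b hab]
  · exact iff_of_true (P.refl a) (Q.refl a)
  · rw [h.1 b a hab, h'.1 b a hab]

/-- The interval-poset of a Tamari interval. -/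
def intervalPoset {S T : TreeOfSize n} (hST : S ≤ T) : LabelledPoset n where
  rel a b := (a ≤ b ∧ treeRel T a b) ∨ (b ≤ a ∧ treeRel S a b)
  refl a := Or.inl ⟨le_rfl, (treePoset T).refl a⟩
  antisymm a b h h' := by
    have hd := le_iff_decLE.mp hST
    rcases lt_trichotomy a b with hab | hab | hab
    · have h1 := (h.resolve_right fun h => hab.not_ge h.1).2
      have h2 := (h'.resolve_left fun h => hab.not_ge h.1).2
      exact (treePoset T).antisymm a b h1 (hd a b hab h2)
    · exact hab
    · have h1 := (h.resolve_left fun h => hab.not_ge h.1).2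
      have h2 := (h'.resolve_right fun h => hab.not_ge h.1).2
      exact (treePoset T).antisymm a b (hd b a hab h1) h2
  trans a b c h h' := by
    -- A mixed chain is moved by `hd` or `hi` into the tree that governs the direction of the
    -- composite.
    have hd : ∀ a b, a ≤ b → treeRel S b a → treeRel T b a := fun a b hab h =>
      hab.eq_or_lt.elim (fun e => e ▸ (treePoset T).refl a)
        fun hab => le_iff_decLE.mp hST a b hab h
    have hi : ∀ a b, a ≤ b → treeRel T a b → treeRel S a b := fun a b hab h =>
      hab.eq_or_lt.elim (fun e => e ▸ (treePoset S).refl a)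
        fun hab => le_iff_incLE.mp hST a b hab h
    have tS := (treePoset S).trans
    have tT := (treePoset T).trans
    rcases h with ⟨hab, h⟩ | ⟨hab, h⟩ <;> rcases h' with ⟨hbc, h'⟩ | ⟨hbc, h'⟩
    · exact Or.inl ⟨hab.trans hbc, tT _ _ _ h h'⟩
    · rcases le_total a c with hac | hac
      · exact Or.inl ⟨hac, tT _ _ _ h (hd _ _ hbc h')⟩
      · exact Or.inr ⟨hac, tS _ _ _ (hi _ _ hab h) h'⟩
    · rcases le_total a c with hac | hac
      · exact Or.inl ⟨hac, tT _ _ _ (hd _ _ hab h) h'⟩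
      · exact Or.inr ⟨hac, tS _ _ _ h (hi _ _ hbc h')⟩
    · exact Or.inr ⟨hbc.trans hab, tS _ _ _ h h'⟩

theorem intervalPoset_encodes {S T : TreeOfSize n} (hST : S ≤ T) :
    Encodes (intervalPoset hST) S T :=
  ⟨fun _ _ hab => ⟨fun h => (h.resolve_left fun h => hab.not_ge h.1).2,
      fun h => Or.inr ⟨hab.le, h⟩⟩,
    fun _ _ hab => ⟨fun h => (h.resolve_right fun h => hab.not_ge h.1).2,
      fun h => Or.inl ⟨hab.le, h⟩⟩⟩

theorem Encodes.isIntervalPoset {P : LabelledPoset n} {S T : TreeOfSize n} (h : Encodes P S T) :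
    P.IsIntervalPoset :=
  ⟨fun a c hr hac b hab hbc => (h.2 b c hbc).mpr
      ((treePoset_isIntervalPoset T).1 a c ((h.2 a c hac).mp hr) hac b hab hbc),
    fun a c hr hac b hab hbc => (h.1 a b hab).mpr
      ((treePoset_isIntervalPoset S).2 a c ((h.1 a c hac).mp hr) hac b hab hbc)⟩

theorem Encodes.linearExtensions_eq_iUnion {P : LabelledPoset n} {S T : TreeOfSize n}
    (h : Encodes P S T) : linearExtensions P.rel = ⋃ U ∈ Set.Icc S T, sylvesterClass U := by
  ext σ
  simp only [Set.mem_iUnion, exists_prop]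
  constructor
  · intro hσ
    obtain ⟨U, hU⟩ := exists_mem_sylvesterClass σ
    have hd := decLE_incLE_of_mem h.isIntervalPoset hσ hU
    exact ⟨U, ⟨le_iff_decLE.mpr fun a b hab hr => hd.1 a b hab ((h.1 a b hab).mpr hr),
      le_iff_incLE.mpr fun a b hab hr => hd.2 a b hab ((h.2 a b hab).mpr hr)⟩, hU⟩
  · rintro ⟨U, ⟨hSU, hUT⟩, hU⟩
    have hU' := mem_linearExtensions (P := treePoset U).mp hU
    exact mem_linearExtensions.mpr
      ⟨fun a b hab hr => hU'.1 a b hab (le_iff_decLE.mp hSU a b hab ((h.1 a b hab).mp hr)),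
        fun a b hab hr => hU'.2 a b hab (le_iff_incLE.mp hUT a b hab ((h.2 a b hab).mp hr))⟩

theorem Encodes.exists_Icc {P : LabelledPoset n} {S T : TreeOfSize n} (h : Encodes P S T) :
    ∃ α ω : Equiv.Perm (Fin n), IsLeast (sylvesterClass S) α ∧ IsGreatest (sylvesterClass T) ω ∧
      linearExtensions P.rel = Set.Icc α ω := by
  obtain ⟨α, hα⟩ := exists_perm_dec h.isIntervalPoset
  obtain ⟨ω, hω⟩ := exists_perm_inc h.isIntervalPoset
  refine ⟨α, ω, isLeast_of_coinversions (P := treePoset S) fun a b => ?_,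
    isGreatest_of_coinversions (P := treePoset T) fun a b => ?_, linearExtensions_eq_Icc hα hω⟩
  · rw [hα]
    exact and_congr_right fun hab => h.1 a b hab
  · rw [hω]
    exact and_congr_right fun hab => not_congr (h.2 a b hab)

/-- The Tamari interval of an interval-poset, as a bijection. -/
theorem exists_equiv_encodes (n : ℕ) :
    ∃ Φ : {P : LabelledPoset n // P.IsIntervalPoset} ≃ NonemptyInterval (TreeOfSize n),
      ∀ P, Encodes P.1 (Φ P).fst (Φ P).snd := by
  choose S T hST h using fun P : {P : LabelledPoset n // P.IsIntervalPoset} => exists_encodes P.2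
  refine ⟨⟨fun P => ⟨(S P, T P), hST P⟩,
    fun I => ⟨intervalPoset I.fst_le_snd, (intervalPoset_encodes I.fst_le_snd).isIntervalPoset⟩,
    fun P => ?_, fun I => ?_⟩, h⟩
  · exact Subtype.ext ((intervalPoset_encodes (hST P)).poset_unique (h P))
  · obtain ⟨h1, h2⟩ := (h ⟨_, (intervalPoset_encodes I.fst_le_snd).isIntervalPoset⟩).unique
      (intervalPoset_encodes I.fst_le_snd)
    exact NonemptyInterval.ext (Prod.ext h1 h2)

/-! ### A labelled poset is determined by its linear extensions -/

theorem exists_mem_linearExtensions (P : LabelledPoset n) :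
    ∃ σ, σ ∈ linearExtensions P.rel := by
  have : IsPartialOrder (Fin n) P.rel :=
    { refl := P.refl, trans := P.trans, antisymm := P.antisymm }
  obtain ⟨s, hs, hPs⟩ := extend_partialOrder P.rel
  have sr := hs.refl
  have st := hs.trans
  have sa := hs.antisymm
  have sl := hs.total
  obtain ⟨σ, hσ⟩ := exists_perm_of_strictTotal (fun a b => s a b ∧ a ≠ b) (by simp)
    (fun a b c h h' => ⟨st _ _ _ h.1 h'.1, by rintro rfl; exact h.2 (sa _ _ h.1 h'.1)⟩)
    (fun a b h => (sl a b).imp (⟨·, h⟩) (⟨·, h.symm⟩))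
  refine ⟨σ, fun a b hr => ?_⟩
  rcases eq_or_ne a b with rfl | hne
  · exact le_rfl
  · exact ((hσ a b).mpr ⟨hPs _ _ hr, hne⟩).le

/-- The labelled poset obtained by adding a relation between incomparable elements. -/
def LabelledPoset.adjoin (P : LabelledPoset n) {b c : Fin n} (h : ¬ P.rel b c) :
    LabelledPoset n where
  rel x y := P.rel x y ∨ (P.rel x c ∧ P.rel b y)
  refl x := Or.inl (P.refl x)
  antisymm x y := by
    rintro (h1 | h1) (h2 | h2)
    · exact P.antisymm x y h1 h2
    · exact absurd (P.trans _ _ _ h2.2 (P.trans _ _ _ h1 h2.1)) h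
    · exact absurd (P.trans _ _ _ h1.2 (P.trans _ _ _ h2 h1.1)) h
    · exact absurd (P.trans _ _ _ h1.2 h2.1) h
  trans x y z := by
    rintro (h1 | h1) (h2 | h2)
    · exact Or.inl (P.trans _ _ _ h1 h2)
    · exact Or.inr ⟨P.trans _ _ _ h1 h2.1, h2.2⟩
    · exact Or.inr ⟨h1.1, P.trans _ _ _ h1.2 h2⟩
    · exact Or.inr ⟨h1.1, h2.2⟩

/-- Otherwise `c ⊲ b` could be adjoined, and a linear extension of the larger poset would put `c`
before `b`. -/
theorem rel_of_forall_linearExtensions {P : LabelledPoset n} {b c : Fin n}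
    (h : ∀ σ ∈ linearExtensions P.rel, σ.symm b < σ.symm c) : P.rel b c := by
  by_contra hr
  obtain ⟨σ, hσ⟩ := exists_mem_linearExtensions (P.adjoin hr)
  exact (h σ fun x y hxy => hσ x y (Or.inl hxy)).not_ge (hσ c b (Or.inr ⟨P.refl c, P.refl b⟩))

/-- An increasing relation of `P` is respected by `ω`, hence holds in `T`. The interval condition in
`T` then yields a non-coinversion of `ω`, so of everything below `ω`, which forces the relation in
`P`. Decreasing relations use `α` and `S`. -/
theorem isIntervalPoset_of_linearExtensions_eq {P : LabelledPoset n} {S T : TreeOfSize n}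
    {α ω : Equiv.Perm (Fin n)} (hα : IsLeast (sylvesterClass S) α)
    (hω : IsGreatest (sylvesterClass T) ω) (h : linearExtensions P.rel = Set.Icc α ω) :
    P.IsIntervalPoset := by
  have cα := coinversions_of_isLeast (treePoset_isIntervalPoset S) hα
  have cω := coinversions_of_isGreatest (treePoset_isIntervalPoset T) hω
  obtain ⟨σ, hσ⟩ := exists_mem_linearExtensions P
  -- The interval is nonempty, so `α` and `ω` themselves extend `P`.
  have hle : α ≤ ω := by
    rw [h] at hσ
    exact hσ.1.trans hσ.2
  have mα := mem_linearExtensions.mp (h ▸ Set.left_mem_Icc.mpr hle : α ∈ linearExtensions P.rel)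
  have mω := mem_linearExtensions.mp (h ▸ Set.right_mem_Icc.mpr hle : ω ∈ linearExtensions P.rel)
  constructor
  · intro a c hr hac b hab hbc
    have hT : treeRel T a c := by
      by_contra hn
      exact mω.2 a c hac hr ((cω a c).mpr ⟨hac, hn⟩)
    refine rel_of_forall_linearExtensions fun τ hτ => not_lt_symm hbc fun hc => ?_
    rw [h] at hτ
    exact ((cω b c).mp (weakOrder_le_iff.mp hτ.2 b c hc)).2
      ((treePoset_isIntervalPoset T).1 a c hT hac b hab hbc)
  · intro a c hr hac b hab hbc
    have hS := ((cα a c).mp (mα.1 a c hac hr)).2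
    refine rel_of_forall_linearExtensions fun τ hτ => ?_
    rw [h] at hτ
    exact (weakOrder_le_iff.mp hτ.1 a b ((cα a b).mpr
      ⟨hab, (treePoset_isIntervalPoset S).2 a c hS hac b hab hbc⟩)).2

end TamariIntervals

theorem mainTheorem3 (n : ℕ) :
    (∃ Φ : {P : TamariIntervals.LabelledPoset n // P.IsIntervalPoset} ≃
          NonemptyInterval (TamariIntervals.TreeOfSize n),
        ∀ P : {P : TamariIntervals.LabelledPoset n // P.IsIntervalPoset},
          TamariIntervals.linearExtensions P.1.rel =
              ⋃ T ∈ Set.Icc (Φ P).fst (Φ P).snd, TamariIntervals.sylvesterClass T ∧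
          ∃ α ω : Equiv.Perm (Fin n),
            IsLeast (TamariIntervals.sylvesterClass (Φ P).fst) α ∧
            IsGreatest (TamariIntervals.sylvesterClass (Φ P).snd) ω ∧
            TamariIntervals.linearExtensions P.1.rel = Set.Icc α ω) ∧
    (∀ P : TamariIntervals.LabelledPoset n,
      P.IsIntervalPoset ↔
        ∃ (T₁ T₂ : TamariIntervals.TreeOfSize n) (α ω : Equiv.Perm (Fin n)),
          IsLeast (TamariIntervals.sylvesterClass T₁) α ∧
          IsGreatest (TamariIntervals.sylvesterClass T₂) ω ∧
          TamariIntervals.linearExtensions P.rel = Set.Icc α ω) := by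
  refine ⟨?_, fun P => ⟨fun hP => ?_, fun ⟨S, T, α, ω, hα, hω, h⟩ =>
    TamariIntervals.isIntervalPoset_of_linearExtensions_eq hα hω h⟩⟩
  · obtain ⟨Φ, hΦ⟩ := TamariIntervals.exists_equiv_encodes n
    exact ⟨Φ, fun P => ⟨(hΦ P).linearExtensions_eq_iUnion, (hΦ P).exists_Icc⟩⟩
  · obtain ⟨S, T, _, h⟩ := TamariIntervals.exists_encodes hP
    exact ⟨S, T, h.exists_Icc⟩
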